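/- Let $G$ be a locally compact (Hausdorff) group with left Haar measure, let $(L_yf)(x)=f(y^{-1}x)$, and let $S(G)$ be a Segal algebra on $G$: a dense linear subspace of $L^1(G)$ with a norm $\|\cdot\|_{S}$ under which it is a Banach space, such that $\|f\|_{1}\le\|f\|_{S}$ for $f\in S(G)$; $L_yf\in S(G)$ and $\|L_yf\|_{S}=\|f\|_{S}$ for all $f\in S(G)$, $y\in G$; and $y\mapsto L_yf$ is continuous from $G$ into $S(G)$ for each $f\in S(G)$. Then $S(G)$ is a Banach algebra under convolution, and its second dual $S(G)^{**}$ is a Banach algebra under the first Arens product. Let $\phi$ be any non-zero (continuous) multiplicative linear functional on $S(G)$, and let $\tilde\phi$ be the character $\tilde\phi(F)=F(\phi)$ of $S(G)^{**}$. For a Banach algebra $A$, let $A\otimes_pA$ be the projective tensor product, with left action $a\cdot(b\otimes c)=ab\otimes c$ and product map $\pi_A(a\otimes b)=ab$; let $(A\otimes_pA)^{**}$ carry the induced left action $a\cdot M=M\circ(f\mapsto f\cdot a)$, where $(f\cdot a)(x)=f(a\cdot x)$ for $f\in(A\otimes_pA)^*$. For a character $\psi$ of $A$, call $A$ left $\psi$-biflat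 if there is a bounded linear map $\rho:A\to(A\otimes_pA)^{**}$ with $$\rho(ab)=\psi(b)\rho(a)=a\cdot\rho(b),\qquad \tilde\psi\big(\pi_A^{**}(\rho(a))\big)=\psi(a)\qquad(a,b\in A),$$ where $\tilde\psi(F)=F(\psi)$ for $F\in A^{**}$. Then the following are equivalent: (i) $S(G)^{**}$ is left $\tilde\phi$-biflat; (ii) $S(G)$ is left $\phi$-biflat; (iii) $G$ is amenable, i.e. there is a left-invariant mean on $L^\infty(G)$: a bounded linear functional $m$ with $\|m\|=m(1)=1$ and $m(L_yf)=m(f)$ for all $y\in G$, $f\in L^\infty(G)$. -/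

import Mathlib

open MeasureTheory Filter Topology
open scoped ENNReal TensorProduct

noncomputable section

namespace SegalBiflat

/-! ### Second duals and the first Arens product -/

/-- The second dual `E**` of a complex normed space. -/
abbrev Bidual (E : Type*) [NormedAddCommGroup E] [NormedSpace ℂ E] : Type _ :=
  StrongDual ℂ (StrongDual ℂ E)

/-- The second adjoint `T** : E** → F**`, `(T** M)(g) = M (g ∘ T)`. -/
def bidualMap {E F : Type*} [NormedAddCommGroup E] [NormedSpace ℂ E]
    [NormedAddCommGroup F] [NormedSpace ℂ F] (T : E →L[ℂ] F) : Bidual E →L[ℂ] Bidual F :=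
  ContinuousLinearMap.precomp ℂ (ContinuousLinearMap.precomp ℂ T)

theorem bidualMap_apply {E F : Type*} [NormedAddCommGroup E] [NormedSpace ℂ E]
    [NormedAddCommGroup F] [NormedSpace ℂ F] (T : E →L[ℂ] F) (M : Bidual E)
    (g : StrongDual ℂ F) : bidualMap T M g = M (g ∘L T) := rfl

section Algebra

variable {A : Type*} [NonUnitalNormedRing A] [NormedSpace ℂ A]
  [IsScalarTower ℂ A A] [SMulCommClass ℂ A A]

/-- For `H ∈ A**` and `f ∈ A*`, the functional `H · f ∈ A*`, `(H · f)(a) = H (f · a)`,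
where `(f · a)(b) = f (a * b)`. -/
def arensAct (H : Bidual A) (f : StrongDual ℂ A) : StrongDual ℂ A :=
  H ∘L (ContinuousLinearMap.compL ℂ A A ℂ f) ∘L (ContinuousLinearMap.mul ℂ A)

theorem arensAct_apply (H : Bidual A) (f : StrongDual ℂ A) (a : A) :
    arensAct H f a = H (f ∘L ContinuousLinearMap.mul ℂ A a) := rfl

theorem norm_arensAct_le (H : Bidual A) (f : StrongDual ℂ A) :
    ‖arensAct H f‖ ≤ ‖H‖ * ‖f‖ := by
  refine ContinuousLinearMap.opNorm_le_bound _ (by positivity) fun a => ?_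
  rw [arensAct_apply, mul_assoc]
  refine (H.le_opNorm _).trans ?_
  gcongr
  refine (ContinuousLinearMap.opNorm_comp_le _ _).trans ?_
  gcongr
  exact ContinuousLinearMap.opNorm_mul_apply_le ℂ A a

/-- The first Arens product on `A**`: `(F □ H)(f) = F (H · f)`. -/
def arensMul (F H : Bidual A) : Bidual A :=
  LinearMap.mkContinuous
    { toFun := fun f => F (arensAct H f)
      map_add' := fun f g => by
        rw [← map_add]; congr 1; ext a
        simp only [arensAct_apply, add_apply, ContinuousLinearMap.add_comp,
          map_add]
      map_smul' := fun c f => by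
        rw [RingHom.id_apply, ← map_smul]; congr 1; ext a
        simp only [arensAct_apply, smul_apply, ContinuousLinearMap.smul_comp,
          map_smul] }
    (‖F‖ * ‖H‖) (fun f => by
      rw [mul_assoc]
      exact (F.le_opNorm _).trans (by gcongr; exact norm_arensAct_le H f))

theorem arensMul_apply (F H : Bidual A) (f : StrongDual ℂ A) :
    arensMul F H f = F (arensAct H f) := rfl

theorem norm_arensMul_le (F H : Bidual A) : ‖arensMul F H‖ ≤ ‖F‖ * ‖H‖ :=
  ContinuousLinearMap.opNorm_le_bound _ (by positivity) fun f => by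
    rw [arensMul_apply, mul_assoc]
    exact (F.le_opNorm _).trans (by gcongr; exact norm_arensAct_le H f)

/-- `A**` as a Banach algebra with the first Arens product. -/
instance instArensRing : NonUnitalNormedRing (Bidual A) where
  __ := (inferInstance : NormedAddCommGroup (Bidual A))
  mul := arensMul
  left_distrib F H K := by
    ext f
    change F (arensAct (H + K) f) = F (arensAct H f) + F (arensAct K f)
    rw [← map_add]; rfl
  right_distrib F H K := rfl
  zero_mul F := rfl
  mul_zero F := by
    ext f
    change F (arensAct 0 f) = 0
    rw [← map_zero F]; rfl
  mul_assoc F H K := by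
    ext f
    change F (arensAct H (arensAct K f)) = F (arensAct (arensMul H K) f)
    congr 1; ext a
    change H _ = H _
    congr 1; ext b
    change K _ = K _
    congr 1; ext c
    simp [mul_assoc]
  norm_mul_le F H := norm_arensMul_le F H

theorem bidual_mul_apply (F H : Bidual A) (f : StrongDual ℂ A) :
    (F * H) f = F (arensAct H f) := rfl

instance instArensScalarTower : IsScalarTower ℂ (Bidual A) (Bidual A) where
  smul_assoc _ _ _ := rfl

instance instArensSMulComm : SMulCommClass ℂ (Bidual A) (Bidual A) where
  smul_comm c F H := by
    ext f
    change c • F (arensAct H f) = F (arensAct (c • H) f)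
    rw [← map_smul]; rfl

/-- The extension `φ̃ ∈ Δ(A**)` of a character `φ ∈ Δ(A)`: `φ̃(F) = F(φ)`. -/
def bidualChar (φ : WeakDual.characterSpace ℂ A) : WeakDual.characterSpace ℂ (Bidual A) :=
  ⟨(ContinuousLinearMap.apply ℂ ℂ (WeakDual.CharacterSpace.toCLM φ) : Bidual A →L[ℂ] ℂ), by
    constructor
    · intro h
      refine φ.2.1 (ContinuousLinearMap.ext fun a => ?_)
      exact DFunLike.congr_fun h (NormedSpace.inclusionInDoubleDual ℂ A a)
    · intro F H
      change F (arensAct H (WeakDual.CharacterSpace.toCLM φ)) =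
        F (WeakDual.CharacterSpace.toCLM φ) * H (WeakDual.CharacterSpace.toCLM φ)
      rw [mul_comm, ← smul_eq_mul, ← map_smul]
      congr 1; ext a
      rw [arensAct_apply, smul_apply, smul_eq_mul, mul_comm, ← smul_eq_mul,
        ← map_smul]
      congr 1; ext b
      exact map_mul φ a b⟩

theorem bidualChar_apply (φ : WeakDual.characterSpace ℂ A) (F : Bidual A) :
    bidualChar φ F = F (WeakDual.CharacterSpace.toCLM φ) := rfl

/-! ### The projective tensor product `A ⊗ₚ A` -/

variable (A) in
/-- The projective tensor product `A ⊗ₚ A`: the completion of the algebraic tensor product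
with respect to the projective norm. -/
abbrev ProjTensor : Type _ := UniformSpace.Completion (⨂[ℂ] _ : Fin 2, A)

/-- The elementary tensor `a ⊗ b`. -/
def tmul (a b : A) : ProjTensor A :=
  ((PiTensorProduct.tprod ℂ ![a, b] : ⨂[ℂ] _ : Fin 2, A) : ProjTensor A)

/-- A bounded bilinear map, as a continuous multilinear map in two variables. -/
def toMultilinear {F : Type*} [NormedAddCommGroup F] [NormedSpace ℂ F]
    (B : A →L[ℂ] A →L[ℂ] F) : ContinuousMultilinearMap ℂ (fun _ : Fin 2 => A) F :=
  MultilinearMap.mkContinuous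
    (MultilinearMap.mk' (fun m => B (m 0) (m 1))
      (fun m i x y => by fin_cases i <;> simp)
      (fun m i c x => by fin_cases i <;> simp)) ‖B‖
    (fun m => by simpa [Fin.prod_univ_two, mul_assoc] using B.le_opNorm₂ (m 0) (m 1))

/-- The bounded linear map on `A ⊗ₚ A` induced by a bounded bilinear map `B`,
`a ⊗ b ↦ B a b`. -/
def projLift {F : Type*} [NormedAddCommGroup F] [NormedSpace ℂ F] [CompleteSpace F]
    (B : A →L[ℂ] A →L[ℂ] F) : ProjTensor A →L[ℂ] F :=
  (PiTensorProduct.liftIsometry ℂ (fun _ : Fin 2 => A) F (toMultilinear B)).extend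
    UniformSpace.Completion.toComplL

theorem projLift_tmul {F : Type*} [NormedAddCommGroup F] [NormedSpace ℂ F] [CompleteSpace F]
    (B : A →L[ℂ] A →L[ℂ] F) (a b : A) : projLift B (tmul a b) = B a b := by
  have h := ContinuousLinearMap.extend_eq
    (PiTensorProduct.liftIsometry ℂ (fun _ : Fin 2 => A) F (toMultilinear B))
    (e := UniformSpace.Completion.toComplL)
    UniformSpace.Completion.denseRange_coe
    (UniformSpace.Completion.isUniformInducing_coe _)
    (PiTensorProduct.tprod ℂ ![a, b])
  refine h.trans ?_
  simp [toMultilinear]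

variable (A) in
/-- The product morphism `π_A : A ⊗ₚ A → A`, `π_A (a ⊗ b) = a b`. -/
def projMul [CompleteSpace A] : ProjTensor A →L[ℂ] A := projLift (ContinuousLinearMap.mul ℂ A)

theorem projMul_tmul [CompleteSpace A] (a b : A) : projMul A (tmul a b) = a * b :=
  projLift_tmul _ a b

/-- The left action of `a` on the algebraic tensor product, `b ⊗ c ↦ (a b) ⊗ c`. -/
def algLeftMul (a : A) : (⨂[ℂ] _ : Fin 2, A) →L[ℂ] (⨂[ℂ] _ : Fin 2, A) :=
  PiTensorProduct.mapL ![ContinuousLinearMap.mul ℂ A a, ContinuousLinearMap.id ℂ A]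

/-- The left action of `a` on `A ⊗ₚ A`, `a · (b ⊗ c) = (a b) ⊗ c`. -/
def projLeftMul (a : A) : ProjTensor A →L[ℂ] ProjTensor A :=
  (UniformSpace.Completion.toComplL ∘L algLeftMul a).extend UniformSpace.Completion.toComplL

theorem projLeftMul_tmul (a b c : A) : projLeftMul a (tmul b c) = tmul (a * b) c := by
  have h := ContinuousLinearMap.extend_eq
    (UniformSpace.Completion.toComplL ∘L algLeftMul a)
    (e := UniformSpace.Completion.toComplL)
    UniformSpace.Completion.denseRange_coe
    (UniformSpace.Completion.isUniformInducing_coe _)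
    (PiTensorProduct.tprod ℂ ![b, c])
  refine h.trans ?_
  simp only [algLeftMul, tmul, ContinuousLinearMap.comp_apply, PiTensorProduct.mapL_apply,
    PiTensorProduct.map_tprod]
  change ((_ : ⨂[ℂ] _ : Fin 2, A) : ProjTensor A) = _
  congr 2
  ext i; fin_cases i <;> simp

/-- The left action `a · M` of `a ∈ A` on `M ∈ (A ⊗ₚ A)**`: `(a · M)(f) = M (f · a)`, where
`(f · a)(x) = f (a · x)`. -/
def bidualLeftMul (a : A) (M : Bidual (ProjTensor A)) : Bidual (ProjTensor A) :=
  bidualMap (projLeftMul a) M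

/-- `A` is left `φ`-biflat: there is a bounded linear map `ρ : A → (A ⊗ₚ A)**` with
`ρ (a b) = φ(b) ρ(a) = a · ρ(b)` and `φ̃ (π** (ρ a)) = φ(a)` for all `a, b`. -/
def IsLeftBiflat [CompleteSpace A] (φ : WeakDual.characterSpace ℂ A) : Prop :=
  ∃ ρ : A →L[ℂ] Bidual (ProjTensor A),
    (∀ a b : A, ρ (a * b) = φ b • ρ a ∧ φ b • ρ a = bidualLeftMul a (ρ b)) ∧
    ∀ a : A, bidualChar φ (bidualMap (projMul A) (ρ a)) = φ a

end Algebra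

/-! ### Translations, amenability and Segal algebras -/

section Group

variable {G : Type*} [Group G] [TopologicalSpace G] [IsTopologicalGroup G]
  [MeasurableSpace G] [BorelSpace G]

/-- Left translation `(L_y f)(x) = f (y⁻¹ x)` on `L^p(G)`, as a linear isometry. -/
def leftTranslate (μ : Measure G) [μ.IsMulLeftInvariant] (p : ℝ≥0∞) [Fact (1 ≤ p)] (y : G) :
    Lp ℂ p μ →ₗᵢ[ℂ] Lp ℂ p μ :=
  Lp.compMeasurePreservingₗᵢ ℂ (fun x => y⁻¹ * x) (measurePreserving_mul_left μ y⁻¹)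

theorem leftTranslate_ae (μ : Measure G) [μ.IsMulLeftInvariant] (p : ℝ≥0∞) [Fact (1 ≤ p)]
    (y : G) (f : Lp ℂ p μ) : leftTranslate μ p y f =ᵐ[μ] fun x => f (y⁻¹ * x) :=
  Lp.coeFn_compMeasurePreserving f (measurePreserving_mul_left μ y⁻¹)

theorem leftTranslate_mul (μ : Measure G) [μ.IsMulLeftInvariant] (p : ℝ≥0∞) [Fact (1 ≤ p)]
    (y z : G) (f : Lp ℂ p μ) :
    leftTranslate μ p (y * z) f = leftTranslate μ p y (leftTranslate μ p z f) := by
  refine Lp.ext ?_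
  have h1 := (measurePreserving_mul_left μ y⁻¹).quasiMeasurePreserving.ae_eq_comp
    (leftTranslate_ae μ p z f)
  filter_upwards [leftTranslate_ae μ p (y * z) f,
    leftTranslate_ae μ p y (leftTranslate μ p z f), h1] with x hx1 hx2 hx3
  rw [hx1, hx2]
  simp only [Function.comp_apply] at hx3
  rw [hx3, mul_inv_rev, mul_assoc]

/-- The locally compact group `G`, with left Haar measure `μ`, is amenable: there is a
left-invariant mean on `L^∞(G)`, i.e. a bounded linear functional `m` with
`‖m‖ = m(1) = 1` and `m (L_y f) = m f` for all `y ∈ G` and `f ∈ L^∞(G)`. -/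
def IsAmenable (μ : Measure G) [μ.IsMulLeftInvariant] : Prop :=
  ∃ m : Lp ℂ ∞ μ →L[ℂ] ℂ,
    ‖m‖ = 1 ∧ m ((memLp_top_const (1 : ℂ)).toLp (fun _ : G => (1 : ℂ))) = 1 ∧
    ∀ (y : G) (f : Lp ℂ ∞ μ), m (leftTranslate μ ∞ y f) = m f

/-- A Segal algebra `S(G)`: a dense linear subspace of `L¹(G)`, with a norm that dominates the
`L¹`-norm and is complete, that is invariant under left translations, on which left translations
act isometrically and strongly continuously. (The norm is given as a seminorm; it is
definite because it dominates the `L¹`-norm.) -/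
structure SegalAlgebra (μ : Measure G) [μ.IsMulLeftInvariant] where
  /-- the underlying subspace of `L¹(G)` -/
  toSubmodule : Submodule ℂ (Lp ℂ 1 μ)
  /-- the norm of `S(G)` -/
  segalNorm : Seminorm ℂ toSubmodule
  dense : Dense (toSubmodule : Set (Lp ℂ 1 μ))
  norm_le_segalNorm : ∀ f : toSubmodule, ‖(f : Lp ℂ 1 μ)‖ ≤ segalNorm f
  complete : ∀ u : ℕ → toSubmodule,
    (∀ ε > 0, ∃ N, ∀ m ≥ N, ∀ n ≥ N, segalNorm (u m - u n) < ε) →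
    ∃ f : toSubmodule, Tendsto (fun n => segalNorm (u n - f)) atTop (𝓝 0)
  translate_mem : ∀ (y : G) (f : toSubmodule), leftTranslate μ 1 y f ∈ toSubmodule
  continuous_translate : ∀ (f : toSubmodule) (y₀ : G),
    Tendsto (fun y : G => segalNorm (⟨leftTranslate μ 1 y f, translate_mem y f⟩ -
      ⟨leftTranslate μ 1 y₀ f, translate_mem y₀ f⟩)) (𝓝 y₀) (𝓝 0)
  norm_translate : ∀ (y : G) (f : toSubmodule),
    segalNorm ⟨leftTranslate μ 1 y f, translate_mem y f⟩ = segalNorm f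

namespace SegalAlgebra

variable {μ : Measure G} [μ.IsMulLeftInvariant]

/-- The elements of `S(G)`; this type carries the norm of `S(G)`. -/
def Elem (S : SegalAlgebra μ) : Type _ := S.toSubmodule

instance : CoeSort (SegalAlgebra μ) (Type _) := ⟨Elem⟩

variable (S : SegalAlgebra μ)

instance : AddCommGroup S := inferInstanceAs (AddCommGroup S.toSubmodule)

instance : Module ℂ S := inferInstanceAs (Module ℂ S.toSubmodule)

instance instNormedAddCommGroup : NormedAddCommGroup S :=
  AddGroupNorm.toNormedAddCommGroup
    { toFun := fun f => S.segalNorm f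
      map_zero' := map_zero S.segalNorm
      add_le' := map_add_le_add S.segalNorm
      neg' := map_neg_eq_map S.segalNorm
      eq_zero_of_map_eq_zero' := fun f hf => by
        have h := S.norm_le_segalNorm f
        rw [hf] at h
        exact Subtype.ext (norm_le_zero_iff.mp h) }

theorem norm_def (f : S) : ‖f‖ = S.segalNorm f := rfl

instance instNormedSpace : NormedSpace ℂ S where
  norm_smul_le c f := (map_smul_eq_mul S.segalNorm c f).le

instance instCompleteSpace : CompleteSpace S := by
  refine Metric.complete_of_cauchySeq_tendsto fun u hu => ?_
  obtain ⟨f, hf⟩ := S.complete u fun ε hε => by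
    obtain ⟨N, hN⟩ := Metric.cauchySeq_iff.mp hu ε hε
    refine ⟨N, fun m hm n hn => ?_⟩
    have := hN m hm n hn
    rwa [dist_eq_norm] at this
  exact ⟨f, tendsto_iff_norm_sub_tendsto_zero.mpr hf⟩

/-- The inclusion `S(G) → L¹(G)`. -/
def incl : S →L[ℂ] Lp ℂ 1 μ :=
  LinearMap.mkContinuous S.toSubmodule.subtype 1 fun f => by
    rw [one_mul]; exact S.norm_le_segalNorm f

theorem incl_injective : Function.Injective S.incl := Subtype.val_injective

/-- Left translation on `S(G)`. -/
def translate (y : G) : S →ₗᵢ[ℂ] S where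
  toFun f := (⟨leftTranslate μ 1 y f.1, S.translate_mem y f⟩ : S.toSubmodule)
  map_add' f g := Subtype.ext (map_add (leftTranslate μ 1 y) f.1 g.1)
  map_smul' c f := Subtype.ext (map_smul (leftTranslate μ 1 y) c f.1)
  norm_map' f := S.norm_translate y f

theorem incl_translate (y : G) (f : S) :
    S.incl (S.translate y f) = leftTranslate μ 1 y (S.incl f) := rfl

theorem translate_mul (y z : G) (f : S) :
    S.translate (y * z) f = S.translate y (S.translate z f) :=
  S.incl_injective (leftTranslate_mul μ 1 y z (S.incl f))

theorem continuous_translate_apply (f : S) : Continuous fun y => S.translate y f :=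
  continuous_iff_continuousAt.mpr fun y₀ =>
    tendsto_iff_norm_sub_tendsto_zero.mpr (S.continuous_translate f y₀)

end SegalAlgebra

/-- On a set of finite measure, a continuous function is a.e. strongly measurable. -/
theorem aestronglyMeasurable_restrict {μ : Measure G} [μ.Regular]
    {E : Type*} [NormedAddCommGroup E] {k : G → E} (hk : Continuous k) {s : Set G}
    (hs : MeasurableSet s) (hμ : μ s ≠ ∞) : AEStronglyMeasurable k (μ.restrict s) := by
  have key : ∀ n : ℕ, ∃ K ⊆ s, IsCompact K ∧ IsClosed K ∧ μ (s \ K) < ((n : ℝ≥0∞) + 1)⁻¹ :=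
    fun n => hs.exists_isCompact_isClosed_sdiff_lt hμ (by simp)
  choose K hKs hKc hKcl hK using key
  have hae : (⋃ n, K n : Set G) =ᵐ[μ] s := by
    refine (Set.iUnion_subset hKs).eventuallyLE.antisymm ?_
    rw [ae_le_set]
    have h0 : Tendsto (fun n : ℕ => ((n : ℝ≥0∞) + 1)⁻¹) atTop (𝓝 0) := by
      have := (tendsto_add_atTop_iff_nat 1).mpr ENNReal.tendsto_inv_nat_nhds_zero
      simpa using this
    refine le_antisymm (ge_of_tendsto' h0 fun n => ?_) zero_le
    exact (measure_mono (Set.sdiff_subset_sdiff_right (Set.subset_iUnion K n))).trans (hK n).le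
  rw [← Measure.restrict_congr_set hae, aestronglyMeasurable_iUnion_iff]
  exact fun n => hk.continuousOn.aestronglyMeasurable_of_isCompact (hKc n)
    (hKcl n).measurableSet

/-- A bounded continuous vector-valued function times an integrable function is integrable. -/
theorem integrable_smul_of_bounded {μ : Measure G} [μ.Regular]
    {E : Type*} [NormedAddCommGroup E] [NormedSpace ℂ E] {f : G → ℂ} (hf : Integrable f μ)
    {k : G → E} (hk : Continuous k) {C : ℝ} (hC : ∀ y, ‖k y‖ ≤ C) :
    Integrable (fun y => f y • k y) μ := by
  have hm : AEStronglyMeasurable (fun y => f y • k y) μ := by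
    obtain ⟨g, hgm, hfg⟩ := hf.1
    have hg : Integrable g μ := hf.congr hfg
    suffices h : AEStronglyMeasurable (fun y => g y • k y) μ by
      refine h.congr ?_
      filter_upwards [hfg] with y hy
      rw [hy]
    let s : ℕ → Set G := fun n => {y | 1 / ((n : ℝ) + 1) ≤ ‖g y‖}
    have hs : ∀ n, MeasurableSet (s n) := fun n =>
      measurableSet_le measurable_const hgm.norm.measurable
    have hsk : AEStronglyMeasurable k (μ.restrict (⋃ n, s n)) :=
      aestronglyMeasurable_iUnion_iff.mpr fun n => aestronglyMeasurable_restrict hk (hs n)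
        (hg.measure_norm_ge_lt_top (by positivity)).ne
    have hind : Set.indicator (⋃ n, s n) (fun y => g y • k y) = fun y => g y • k y := by
      refine Set.indicator_eq_self.mpr fun y hy => ?_
      have hgy : 0 < ‖g y‖ := norm_pos_iff.mpr fun h0 => hy (by simp [h0])
      obtain ⟨n, hn⟩ := exists_nat_one_div_lt hgy
      exact Set.mem_iUnion.mpr ⟨n, hn.le⟩
    rw [← hind, aestronglyMeasurable_indicator_iff (MeasurableSet.iUnion hs)]
    exact hgm.aestronglyMeasurable.smul hsk
  refine (hf.norm.mul_const C).mono' hm (Eventually.of_forall fun y => ?_)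
  rw [norm_smul]
  gcongr
  exact hC y

section Convolution

/-- Convolution on `L¹(G)`, `(f * g)(x) = ∫ f(y) g(y⁻¹ x) dy`, as the `L¹(G)`-valued integral
`f * g = ∫ f(y) L_y g dy`. -/
def l1Conv (μ : Measure G) [μ.IsMulLeftInvariant] (f g : Lp ℂ 1 μ) : Lp ℂ 1 μ :=
  ∫ y, f y • leftTranslate μ 1 y g ∂μ

namespace SegalAlgebra

variable {μ : Measure G} [μ.IsMulLeftInvariant] [μ.Regular] (S : SegalAlgebra μ)

theorem integrable_translate (f : Lp ℂ 1 μ) (g : S) :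
    Integrable (fun y => f y • S.translate y g) μ :=
  integrable_smul_of_bounded (L1.integrable_coeFn f) (S.continuous_translate_apply g)
    (C := ‖g‖) fun y => ((S.translate y).norm_map g).le

theorem incl_integral_translate (f : Lp ℂ 1 μ) (g : S) :
    S.incl (∫ y, f y • S.translate y g ∂μ) = l1Conv μ f (S.incl g) := by
  rw [← S.incl.integral_comp_comm (S.integrable_translate f g)]
  simp only [map_smul, incl_translate, l1Conv]

/-- `S(G)` is a left ideal of `L¹(G)`. -/
theorem l1Conv_mem (f : Lp ℂ 1 μ) (g : S) : l1Conv μ f (S.incl g) ∈ S.toSubmodule := by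
  rw [← S.incl_integral_translate f g]
  exact (∫ y, f y • S.translate y g ∂μ : S).2

/-- The product of `S(G)` is convolution. -/
instance instMul : Mul S :=
  ⟨fun f g => (⟨l1Conv μ (S.incl f) (S.incl g), S.l1Conv_mem (S.incl f) g⟩ : S.toSubmodule)⟩

theorem incl_mul (f g : S) : S.incl (f * g) = l1Conv μ (S.incl f) (S.incl g) := rfl

theorem mul_eq_integral (f g : S) : f * g = ∫ y, S.incl f y • S.translate y g ∂μ :=
  S.incl_injective (S.incl_integral_translate (S.incl f) g).symm

theorem add_mul_aux (f g h : S) : (f + g) * h = f * h + g * h := by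
  simp only [mul_eq_integral]
  rw [← integral_add (S.integrable_translate _ h) (S.integrable_translate _ h)]
  refine integral_congr_ae ?_
  rw [map_add]
  filter_upwards [Lp.coeFn_add (S.incl f) (S.incl g)] with y hy
  rw [hy, Pi.add_apply, add_smul]

theorem smul_mul_aux (c : ℂ) (f h : S) : (c • f) * h = c • (f * h) := by
  simp only [mul_eq_integral]
  rw [← integral_smul]
  refine integral_congr_ae ?_
  rw [map_smul]
  filter_upwards [Lp.coeFn_smul c (S.incl f)] with y hy
  rw [hy, Pi.smul_apply, smul_assoc]

theorem mul_add_aux (f g h : S) : f * (g + h) = f * g + f * h := by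
  simp only [mul_eq_integral, map_add, smul_add]
  exact integral_add (S.integrable_translate _ g) (S.integrable_translate _ h)

theorem mul_smul_aux (c : ℂ) (f g : S) : f * (c • g) = c • (f * g) := by
  simp only [mul_eq_integral, map_smul]
  rw [← integral_smul]
  simp only [smul_comm c]

theorem norm_mul_aux (f g : S) : ‖f * g‖ ≤ ‖f‖ * ‖g‖ := by
  rw [mul_eq_integral]
  refine (norm_integral_le_integral_norm _).trans ?_
  simp only [norm_smul, LinearIsometry.norm_map]
  rw [integral_mul_const, ← L1.norm_eq_integral_norm]
  gcongr
  exact S.norm_le_segalNorm f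

/-- Left translation commutes with right convolution. -/
theorem translate_mul_aux (z : G) (f g : S) : S.translate z f * g = S.translate z (f * g) := by
  simp only [mul_eq_integral]
  have h1 := (S.translate z).toContinuousLinearMap.integral_comp_comm
    (S.integrable_translate (S.incl f) g)
  simp only [LinearIsometry.coe_toContinuousLinearMap, map_smul] at h1
  rw [← h1]
  have h2 := integral_mul_left_eq_self (μ := μ)
    (fun y => S.incl f y • S.translate z (S.translate y g)) z⁻¹
  rw [← h2]
  refine integral_congr_ae ?_
  rw [incl_translate]
  filter_upwards [leftTranslate_ae μ 1 z (S.incl f)] with y hy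
  rw [hy, ← translate_mul, mul_inv_cancel_left]

theorem mul_assoc_aux (f g h : S) : f * g * h = f * (g * h) := by
  let T : S →L[ℂ] S := LinearMap.mkContinuous
    { toFun := fun k => k * h
      map_add' := fun k l => S.add_mul_aux k l h
      map_smul' := fun c k => S.smul_mul_aux c k h } ‖h‖
    fun k => by rw [mul_comm]; exact S.norm_mul_aux k h
  change T (f * g) = _
  rw [mul_eq_integral, mul_eq_integral, ← T.integral_comp_comm (S.integrable_translate _ g)]
  refine integral_congr_ae (Eventually.of_forall fun y => ?_)
  simp only [map_smul]
  congr 1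
  exact S.translate_mul_aux y g h

/-- `S(G)` as a Banach algebra under convolution. -/
instance instNonUnitalNormedRing : NonUnitalNormedRing S where
  __ := instNormedAddCommGroup S
  mul := (· * ·)
  left_distrib := S.mul_add_aux
  right_distrib := S.add_mul_aux
  zero_mul f := by
    have h := S.smul_mul_aux 0 0 f
    simpa only [zero_smul] using h
  mul_zero f := by
    have h := S.mul_smul_aux 0 f 0
    simpa only [zero_smul] using h
  mul_assoc := S.mul_assoc_aux
  norm_mul_le := S.norm_mul_aux

instance instIsScalarTower : IsScalarTower ℂ S S := ⟨S.smul_mul_aux⟩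

instance instSMulCommClass : SMulCommClass ℂ S S := ⟨fun c f g => (S.mul_smul_aux c f g).symm⟩

end SegalAlgebra

end Convolution

end Group

end SegalBiflat

end

noncomputable section

namespace SegalBiflat

/-! ### Left character-amenability and left biflatness of Banach algebras -/

section LeftAmenable

/-! All three conditions are compared with left `φ`-amenability of `S(G)` (`IsLeftAmenable`): a
functional `N` on the dual with `N φ = 1` that turns the module action of `a` into multiplication by
`φ a`.

Algebra: such an `N` gives biflatness by tensoring with a fixed `b`, `φ b = 1`, and its canonical
image does the same for the second dual. Conversely, if every `b` lies in the closure of `A * b`,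
then `ρ (a * b) = φ b • ρ a` forces `ρ` to vanish on `ker φ`. So `ρ` is `φ` times a fixed element
`M`, and `π** M` is the required functional. For the second dual this is needed only along the image
of `A` (`IsLeftBiflat.exists_bidual`). Segal algebras satisfy the closure condition because
translation is continuous and `S(G)` is dense in `L¹(G)`.

Analysis: a character of `S(G)` is integration against a bounded continuous homomorphism `χ : G →*
ℂ`. Multiplying by `χ` turns `N` into a translation-invariant functional on `L^∞(G)`, whose
normalised positive part is a mean. In the other direction, a mean applied to `χ x⁻¹ * f (L_x e)`,
where `φ e = 1`, gives a translation-covariant functional on `S(G)*`, and averaging over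
translations makes it module-covariant (`isLeftAmenable_of_translate`). -/

theorem exists_char_eq_one {A : Type*} [NonUnitalNormedRing A] [NormedSpace ℂ A]
    (φ : WeakDual.characterSpace ℂ A) :
    ∃ a : A, φ a = 1 := by
  obtain ⟨b, hb⟩ : ∃ b : A, φ b ≠ 0 := by
    by_contra! h
    exact φ.2.1 (ContinuousLinearMap.ext h)
  exact ⟨(φ b)⁻¹ • b, by rw [map_smul, smul_eq_mul, inv_mul_cancel₀ hb]⟩

variable {A : Type*} [NonUnitalNormedRing A] [NormedSpace ℂ A]
  [IsScalarTower ℂ A A] [SMulCommClass ℂ A A]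

/-- `A` is left `φ`-amenable: there is `N ∈ A**` with `N φ = 1` and `N (f · a) = φ a N f`. -/
def IsLeftAmenable (φ : WeakDual.characterSpace ℂ A) : Prop :=
  ∃ N : Bidual A, N (WeakDual.CharacterSpace.toCLM φ) = 1 ∧
    ∀ (a : A) (f : StrongDual ℂ A), N (f ∘L ContinuousLinearMap.mul ℂ A a) = φ a * N f

theorem projTensor_ext {F : Type*} [NormedAddCommGroup F] [NormedSpace ℂ F]
    {T U : ProjTensor A →L[ℂ] F} (h : ∀ a b : A, T (tmul a b) = U (tmul a b)) : T = U := by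
  have h1 : (T : ProjTensor A →ₗ[ℂ] F) ∘ₗ
        (UniformSpace.Completion.toComplL : (⨂[ℂ] _ : Fin 2, A) →L[ℂ] ProjTensor A).toLinearMap =
      (U : ProjTensor A →ₗ[ℂ] F) ∘ₗ
        (UniformSpace.Completion.toComplL : (⨂[ℂ] _ : Fin 2, A) →L[ℂ] ProjTensor A).toLinearMap := by
    refine PiTensorProduct.ext (MultilinearMap.ext fun m => ?_)
    have hm : m = ![m 0, m 1] := by ext i; fin_cases i <;> rfl
    rw [hm]
    exact h (m 0) (m 1)
  ext x
  refine UniformSpace.Completion.induction_on x (isClosed_eq T.continuous U.continuous) fun y => ?_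
  exact LinearMap.congr_fun h1 y

/-- The map `a ↦ a ⊗ b`. -/
def tmulRight (b : A) : A →L[ℂ] ProjTensor A :=
  UniformSpace.Completion.toComplL ∘L
    (PiTensorProduct.tprodL ℂ (E := fun _ : Fin 2 => A)).toContinuousLinearMap ![b, b] 0

theorem tmulRight_apply (a b : A) : tmulRight b a = tmul a b := by
  change ((PiTensorProduct.tprod ℂ (Function.update ![b, b] 0 a) : ⨂[ℂ] _ : Fin 2, A) :
    ProjTensor A) = _
  rw [tmul]
  congr 2
  ext i; fin_cases i <;> rfl

theorem projMul_comp_projLeftMul [CompleteSpace A] (a : A) :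
    projMul A ∘L projLeftMul a = ContinuousLinearMap.mul ℂ A a ∘L projMul A :=
  projTensor_ext fun b c => by
    simp [projLeftMul_tmul, projMul_tmul, mul_assoc]

theorem projLeftMul_comp_tmulRight (a b : A) :
    projLeftMul a ∘L tmulRight b = tmulRight b ∘L ContinuousLinearMap.mul ℂ A a := by
  ext c
  simp [tmulRight_apply, projLeftMul_tmul]

/-- Pushing `N` forward along `a ↦ a ⊗ b` with `φ b = 1` gives `M` with `a · M = φ a • M`; then `ρ a
= φ a • M` works. -/
theorem IsLeftAmenable.isLeftBiflat [CompleteSpace A] {φ : WeakDual.characterSpace ℂ A}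
    (h : IsLeftAmenable φ) : IsLeftBiflat φ := by
  obtain ⟨N, hN1, hN⟩ := h
  obtain ⟨b, hb⟩ := exists_char_eq_one φ
  have hM : ∀ a : A, bidualLeftMul a (bidualMap (tmulRight b) N) =
      φ a • bidualMap (tmulRight b) N := fun a => by
    ext f
    change N ((f ∘L projLeftMul a) ∘L tmulRight b) = φ a * N (f ∘L tmulRight b)
    rw [ContinuousLinearMap.comp_assoc, projLeftMul_comp_tmulRight, ← hN]
    rfl
  refine ⟨(WeakDual.CharacterSpace.toCLM φ).smulRight (bidualMap (tmulRight b) N),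
    fun a c => ⟨?_, ?_⟩, fun a => ?_⟩
  · change φ (a * c) • bidualMap (tmulRight b) N = φ c • φ a • bidualMap (tmulRight b) N
    rw [map_mul, smul_smul, mul_comm]
  · change φ c • φ a • bidualMap (tmulRight b) N =
      bidualMap (projLeftMul a) (φ c • bidualMap (tmulRight b) N)
    rw [map_smul]
    congr 1
    exact (hM a).symm
  · have hφ : (WeakDual.CharacterSpace.toCLM φ ∘L projMul A) ∘L tmulRight b =
        WeakDual.CharacterSpace.toCLM φ := by
      ext c
      change φ (projMul A (tmulRight b c)) = φ c
      rw [tmulRight_apply, projMul_tmul, map_mul, hb, mul_one]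
    change φ a * N ((WeakDual.CharacterSpace.toCLM φ ∘L projMul A) ∘L tmulRight b) = φ a
    rw [hφ, hN1, mul_one]

/-- Covariance says `arensAct N f = N f • φ`, hence `F * N = F φ • N` for every `F` in the second
dual. So evaluation at `N` is the required functional. -/
theorem IsLeftAmenable.bidual {φ : WeakDual.characterSpace ℂ A} (h : IsLeftAmenable φ) :
    IsLeftAmenable (A := Bidual A) (bidualChar φ) := by
  obtain ⟨N, hN1, hN⟩ := h
  refine ⟨NormedSpace.inclusionInDoubleDual ℂ (Bidual A) N, hN1, fun F Φ => ?_⟩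
  have hFN : F * N = bidualChar φ F • N := by
    ext f
    rw [bidual_mul_apply, bidualChar_apply]
    have : arensAct N f = N f • WeakDual.CharacterSpace.toCLM φ := by
      ext a
      rw [arensAct_apply, hN, mul_comm]
      rfl
    rw [this, map_smul, smul_eq_mul, mul_comm]
    rfl
  change Φ (F * N) = _
  rw [hFN, map_smul]
  rfl

/-- A left biflat algebra `B` is left amenable with respect to a homomorphic image of an
algebra `A` in which every `b` lies in the closure of `A * b`. -/
theorem IsLeftBiflat.exists_bidual {A B : Type*} [NonUnitalNormedRing A] [NormedSpace ℂ A]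
    [NonUnitalNormedRing B] [NormedSpace ℂ B]
    [IsScalarTower ℂ B B] [SMulCommClass ℂ B B] [CompleteSpace B]
    {φ : WeakDual.characterSpace ℂ A} {ψ : WeakDual.characterSpace ℂ B} (h : IsLeftBiflat ψ)
    (j : A →L[ℂ] B) (hj : ∀ a b, j (a * b) = j a * j b) (hψ : ∀ a, ψ (j a) = φ a)
    (happrox : ∀ b : A, b ∈ closure (Set.range fun a : A => a * b)) :
    ∃ N : Bidual B, N (WeakDual.CharacterSpace.toCLM ψ) = 1 ∧
      ∀ (a : A) (f : StrongDual ℂ B),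
        N (f ∘L ContinuousLinearMap.mul ℂ B (j a)) = φ a * N f := by
  obtain ⟨ρ, hρ, hρ1⟩ := h
  obtain ⟨e, he⟩ := exists_char_eq_one φ
  -- `ρ ∘ j` kills every product `a * b` with `φ b = 0`, and `b` is a limit of such products. Thus
  -- `ρ ∘ j` factors through `φ`.
  have hker : ∀ b : A, φ b = 0 → ρ (j b) = 0 := fun b hb => by
    have hcl : IsClosed {a : A | ρ (j a) = 0} :=
      isClosed_eq (ρ.continuous.comp j.continuous) continuous_const
    refine closure_minimal ?_ hcl (happrox b)
    rintro _ ⟨a, rfl⟩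
    change ρ (j (a * b)) = 0
    rw [hj, (hρ _ _).1, hψ, hb]
    exact zero_smul ℂ (ρ (j a))
  have hρe : ∀ b : A, ρ (j b) = φ b • ρ (j e) := fun b => by
    have h0 : ρ (j (b - φ b • e)) = 0 := hker _ (by
      rw [map_sub, map_smul, he, smul_eq_mul, mul_one, sub_self])
    have h1 : ρ (j b) = ρ (j (b - φ b • e)) + φ b • ρ (j e) := by
      rw [← ρ.map_smul, ← j.map_smul, ← ρ.map_add, ← j.map_add, sub_add_cancel]
    rw [h1, h0, zero_add]
  refine ⟨bidualMap (projMul B) (ρ (j e)), ?_, fun a f => ?_⟩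
  · rw [← bidualChar_apply, hρ1, hψ, he]
  -- The second biflatness identity at `e`, where `φ e = 1`, reads `ρ (j a) = j a · ρ (j e)`.
  · have h1 : bidualLeftMul (j a) (ρ (j e)) = φ a • ρ (j e) := by
      rw [← hρe, ← one_smul ℂ (ρ (j a)), ← he, ← hψ, (hρ _ _).2]
    have h2 := DFunLike.congr_fun h1 (f ∘L projMul B)
    change ρ (j e) ((f ∘L ContinuousLinearMap.mul ℂ B (j a)) ∘L projMul B) = _
    rw [ContinuousLinearMap.comp_assoc, ← projMul_comp_projLeftMul, ← ContinuousLinearMap.comp_assoc]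
    exact h2

theorem IsLeftBiflat.isLeftAmenable [CompleteSpace A] {φ : WeakDual.characterSpace ℂ A}
    (h : IsLeftBiflat φ)
    (happrox : ∀ b : A, b ∈ closure (Set.range fun a : A => a * b)) : IsLeftAmenable φ :=
  h.exists_bidual (ContinuousLinearMap.id ℂ A) (fun _ _ => rfl) (fun _ => rfl) happrox

theorem inclusionInDoubleDual_mul (a b : A) :
    NormedSpace.inclusionInDoubleDual ℂ A (a * b) =
      NormedSpace.inclusionInDoubleDual ℂ A a * NormedSpace.inclusionInDoubleDual ℂ A b :=
  rfl

/-- Taking `j` to be the canonical embedding, the closure condition is needed in `A` only. The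
functional obtained on the third dual is then restricted to the copy of `A*` inside it. -/
theorem IsLeftBiflat.isLeftAmenable_of_bidual {φ : WeakDual.characterSpace ℂ A}
    (h : IsLeftBiflat (A := Bidual A) (bidualChar φ))
    (happrox : ∀ b : A, b ∈ closure (Set.range fun a : A => a * b)) : IsLeftAmenable φ := by
  obtain ⟨N, hN1, hN⟩ := h.exists_bidual (φ := φ) (NormedSpace.inclusionInDoubleDual ℂ A)
    inclusionInDoubleDual_mul (fun _ => rfl) happrox
  exact ⟨N ∘L NormedSpace.inclusionInDoubleDual ℂ (StrongDual ℂ A), hN1,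
    fun a f => hN a (NormedSpace.inclusionInDoubleDual ℂ (StrongDual ℂ A) f)⟩

end LeftAmenable

/-! ### Left approximate units and characters of a Segal algebra -/

section Approximation

variable {G : Type*} [Group G] [TopologicalSpace G] [IsTopologicalGroup G]
  [MeasurableSpace G] [BorelSpace G]

namespace SegalAlgebra

theorem translate_one {μ : Measure G} [μ.IsMulLeftInvariant] (S : SegalAlgebra μ) (c : S) :
    S.translate 1 c = c :=
  (S.translate 1).injective (by rw [← translate_mul, mul_one])

section Action

variable {μ : Measure G} [μ.IsMulLeftInvariant] [μ.Regular] (S : SegalAlgebra μ)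

/-- The action `c ↦ e * c` of `e ∈ L¹(G)` on `S(G)`. -/
def l1Act (e : Lp ℂ 1 μ) : S →L[ℂ] S :=
  LinearMap.mkContinuous
    { toFun := fun c => ∫ y, e y • S.translate y c ∂μ
      map_add' := fun c d => by
        simp only [map_add, smul_add]
        exact integral_add (S.integrable_translate _ c) (S.integrable_translate _ d)
      map_smul' := fun k c => by
        simp only [map_smul, RingHom.id_apply]
        rw [← integral_smul]
        simp only [smul_comm k] } ‖e‖ fun c => by
    refine (norm_integral_le_integral_norm _).trans ?_
    simp only [norm_smul, LinearIsometry.norm_map]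
    rw [integral_mul_const, ← L1.norm_eq_integral_norm]

theorem l1Act_apply (e : Lp ℂ 1 μ) (c : S) : S.l1Act e c = ∫ y, e y • S.translate y c ∂μ := rfl

theorem norm_l1Act_apply_le (e : Lp ℂ 1 μ) (c : S) : ‖S.l1Act e c‖ ≤ ‖e‖ * ‖c‖ :=
  (S.l1Act e).le_of_opNorm_le (LinearMap.mkContinuous_norm_le _ (norm_nonneg e) _) c

theorem l1Act_incl (a c : S) : S.l1Act (S.incl a) c = a * c := (S.mul_eq_integral a c).symm

theorem l1Act_sub (e e' : Lp ℂ 1 μ) (c : S) :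
    S.l1Act (e - e') c = S.l1Act e c - S.l1Act e' c := by
  simp only [l1Act_apply]
  rw [← integral_sub (S.integrable_translate _ c) (S.integrable_translate _ c)]
  refine integral_congr_ae ?_
  filter_upwards [Lp.coeFn_sub e e'] with y hy
  rw [hy, Pi.sub_apply, sub_smul]

theorem l1Act_mul (e : Lp ℂ 1 μ) (a b : S) : S.l1Act e (a * b) = S.l1Act e a * b := by
  have h := ((ContinuousLinearMap.mul ℂ S).flip b).integral_comp_comm (S.integrable_translate e a)
  simp only [map_smul, ContinuousLinearMap.flip_apply, ContinuousLinearMap.mul_apply',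
    translate_mul_aux] at h
  exact h

end Action

variable [LocallyCompactSpace G] {μ : Measure G} [μ.IsHaarMeasure] [μ.Regular]
  (S : SegalAlgebra μ)

/-- `u` is a bump of integral one that vanishes wherever translation moves `b` by `ε` or more, so `u
* b` is an average of points `ε`-close to `b`. -/
theorem exists_l1Act_sub_le (b : S) {ε : ℝ} (hε : 0 < ε) :
    ∃ (u : G → ℂ) (hu : Continuous u) (hc : HasCompactSupport u),
      ‖S.l1Act ((hu.memLp_of_hasCompactSupport hc).toLp u) b - b‖ ≤ ε := by
  have hU : IsOpen {y : G | ‖S.translate y b - b‖ < ε} :=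
    isOpen_lt ((S.continuous_translate_apply b).sub continuous_const).norm continuous_const
  have hε' : ‖S.translate 1 b - b‖ < ε := by rwa [translate_one, sub_self, norm_zero]
  obtain ⟨v, hv1, hv0, hvc, hv⟩ := exists_continuous_one_zero_of_isCompact
    (isCompact_singleton (x := (1 : G))) hU.isClosed_compl (by simpa using hε')
  have hv1 : v 1 = 1 := hv1 rfl
  have hI : 0 < ∫ y, v y ∂μ := v.continuous.integral_pos_of_hasCompactSupport_nonneg_nonzero hvc
    (fun y => (hv y).1) (x := 1) (by simp [hv1])
  set I := ∫ y, v y ∂μ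
  have hu : Continuous fun y => ((v y / I : ℝ) : ℂ) := by fun_prop
  have huc : HasCompactSupport fun y => ((v y / I : ℝ) : ℂ) := by
    refine hvc.comp_left (g := fun t : ℝ => ((t / I : ℝ) : ℂ)) (by simp)
  refine ⟨_, hu, huc, ?_⟩
  set e := (hu.memLp_of_hasCompactSupport (μ := μ) (p := 1) huc).toLp _
  have hae : e =ᵐ[μ] fun y => ((v y / I : ℝ) : ℂ) := MemLp.coeFn_toLp _
  have hint : Integrable (fun y => v y / I) μ :=
    (v.continuous.integrable_of_hasCompactSupport hvc).div_const I
  have h1 : ∫ y, v y / I ∂μ = 1 := by rw [integral_div, div_self hI.ne']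
  have hb : b = ∫ y, e y • b ∂μ := by
    rw [integral_smul_const, integral_congr_ae hae, integral_complex_ofReal, h1]
    simp
  have hsub : S.l1Act e b - b = ∫ y, e y • (S.translate y b - b) ∂μ := by
    conv_lhs => rw [hb]
    rw [l1Act_apply, ← integral_sub]
    · rw [← hb]; simp only [smul_sub]
    · rw [← hb]; exact S.integrable_translate e b
    · exact (L1.integrable_coeFn e).smul_const b
  rw [hsub]
  calc ‖∫ y, e y • (S.translate y b - b) ∂μ‖ ≤ ∫ y, v y / I * ε ∂μ := by
        refine norm_integral_le_of_norm_le (hint.mul_const ε) ?_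
        filter_upwards [hae] with y hy
        have hvI : 0 ≤ v y / I := div_nonneg (hv y).1 hI.le
        rw [norm_smul, hy, Complex.norm_real, Real.norm_of_nonneg hvI]
        by_cases hyU : ‖S.translate y b - b‖ < ε
        · gcongr
        · rw [show v y = 0 from hv0 hyU]
          simp
    _ = ε := by rw [integral_mul_const, h1, one_mul]

/-- The bump need not lie in `S(G)`. Since `‖e * b‖` is controlled by the `L¹`-norm of `e`, density
allows it to be replaced by an element of `S(G)`. -/
theorem mem_closure_range_mul (b : S) : b ∈ closure (Set.range fun a : S => a * b) := by
  rw [Metric.mem_closure_range_iff]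
  intro ε hε
  obtain ⟨u, hu, hc, hub⟩ := S.exists_l1Act_sub_le b (half_pos hε)
  set e := (hu.memLp_of_hasCompactSupport (μ := μ) hc (p := 1)).toLp u
  have hδ : 0 < ε / 2 / (‖b‖ + 1) := by positivity
  obtain ⟨a, ha, hae⟩ := Metric.mem_closure_iff.mp (S.dense e) _ hδ
  refine ⟨(⟨a, ha⟩ : S.toSubmodule), ?_⟩
  let a' : S := (⟨a, ha⟩ : S.toSubmodule)
  change dist b (a' * b) < ε
  have h1 : ‖S.l1Act e b - a' * b‖ < ε / 2 := by
    rw [← l1Act_incl, ← l1Act_sub]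
    refine (S.norm_l1Act_apply_le _ b).trans_lt ?_
    rw [dist_eq_norm, lt_div_iff₀ (by positivity)] at hae
    refine lt_of_le_of_lt ?_ hae
    gcongr
    · exact le_rfl
    · linarith
  calc dist b (a' * b) ≤ dist b (S.l1Act e b) + dist (S.l1Act e b) (a' * b) := dist_triangle _ _ _
    _ = ‖S.l1Act e b - b‖ + ‖S.l1Act e b - a' * b‖ := by
      rw [dist_comm b, dist_eq_norm, dist_eq_norm]
    _ < ε := by linarith

/-- From `φ (L_y (a * b)) = φ (L_y a) * φ b` and the closure condition, `φ ∘ L_y` vanishes on `ker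
φ`, so it is a multiple `χ y` of `φ`. With `φ e = 1` this means `χ y = φ (L_y e)`, and the integral
formula is `φ` applied to `b * e = ∫ b(y) L_y e dy`. -/
theorem exists_monoidHom_of_char (φ : WeakDual.characterSpace ℂ S) :
    ∃ χ : G →* ℂ, Continuous χ ∧ (∃ C, ∀ y, ‖χ y‖ ≤ C) ∧
      (∀ y b, φ (S.translate y b) = χ y * φ b) ∧ ∀ b, φ b = ∫ y, S.incl b y * χ y ∂μ := by
  obtain ⟨e, he⟩ := exists_char_eq_one φ
  have hφc : Continuous φ := (WeakDual.CharacterSpace.toCLM φ).continuous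
  have hker : ∀ y b, φ b = 0 → φ (S.translate y b) = 0 := fun y b hb => by
    have hcl : IsClosed {c : S | φ (S.translate y c) = 0} :=
      isClosed_eq (hφc.comp (S.translate y).continuous) continuous_const
    refine closure_minimal ?_ hcl (S.mem_closure_range_mul b)
    rintro _ ⟨a, rfl⟩
    change φ (S.translate y (a * b)) = 0
    rw [← translate_mul_aux, map_mul, hb, mul_zero]
  have hχ : ∀ y b, φ (S.translate y b) = φ (S.translate y e) * φ b := fun y b => by
    have h0 := hker y (b - φ b • e) (by
      rw [map_sub, map_smul, he, smul_eq_mul, mul_one, sub_self])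
    rw [map_sub, map_smul, map_sub, map_smul, sub_eq_zero] at h0
    rw [h0, smul_eq_mul, mul_comm]
  refine ⟨{ toFun := fun y => φ (S.translate y e), map_one' := by rw [translate_one, he],
            map_mul' := fun y z => by rw [translate_mul, hχ y] },
    hφc.comp (S.continuous_translate_apply e),
    ⟨‖WeakDual.CharacterSpace.toCLM φ‖ * ‖e‖, fun y => ?_⟩, hχ, fun b => ?_⟩
  · refine ((WeakDual.CharacterSpace.toCLM φ).le_opNorm _).trans ?_
    rw [LinearIsometry.norm_map]
  · have h := (WeakDual.CharacterSpace.toCLM φ).integral_comp_comm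
      (S.integrable_translate (S.incl b) e)
    rw [← mul_eq_integral] at h
    simp only [map_smul, smul_eq_mul] at h
    change _ = φ (b * e) at h
    rw [map_mul, he, mul_one] at h
    exact h.symm

end SegalAlgebra

end Approximation

/-! ### Right translation, and from translation covariance to module covariance -/

section RightTranslation

open scoped Pointwise in
/-- If `u` is continuous with compact support, then so is `x ↦ u (x * y)`, locally uniformly
in `y`. -/
theorem exists_isCompact_forall_mul_eq_zero {G : Type*} [Group G]
    [TopologicalSpace G] [IsTopologicalGroup G] [LocallyCompactSpace G] {E : Type*} [Zero E] {u : G → E}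
    (hc : HasCompactSupport u) (y₀ : G) :
    ∃ V ∈ 𝓝 y₀, ∃ K : Set G, IsCompact K ∧ ∀ y ∈ V, ∀ x, x ∉ K → u (x * y) = 0 := by
  obtain ⟨V, hVc, hV⟩ := exists_compact_mem_nhds y₀
  refine ⟨V, hV, tsupport u * V⁻¹, hc.isCompact.mul hVc.inv, fun y hy x hx => ?_⟩
  refine image_eq_zero_of_notMem_tsupport fun h => hx ?_
  exact Set.mem_mul.mpr ⟨x * y, h, y⁻¹, Set.inv_mem_inv.mpr hy, mul_inv_cancel_right x y⟩

variable {G : Type*} [Group G] [TopologicalSpace G] [IsTopologicalGroup G]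
  [LocallyCompactSpace G] [MeasurableSpace G] [BorelSpace G]

/-- The modular function: right translation scales a left Haar measure by a continuous factor. -/
theorem exists_continuous_integral_mul_right (μ : Measure G) [μ.IsHaarMeasure] [μ.Regular] :
    ∃ c : G → ℝ, Continuous c ∧
      ∀ (y : G) (F : G → ℂ), ∫ x, F (x * y) ∂μ = c y • ∫ x, F x ∂μ := by
  have hmap : ∀ y : G, Measure.map (· * y) μ =
      Measure.haarScalarFactor (Measure.map (· * y) μ) μ • μ := fun y => by
    have : (Measure.map (· * y) μ).Regular := Measure.Regular.map (Homeomorph.mulRight y)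
    exact Measure.isMulLeftInvariant_eq_smul_of_regular _ μ
  set c : G → ℝ := fun y => Measure.haarScalarFactor (Measure.map (· * y) μ) μ
  have hc : ∀ (y : G) (F : G → ℂ), ∫ x, F (x * y) ∂μ = c y • ∫ x, F x ∂μ := fun y F => by
    have h := (Homeomorph.mulRight y).measurableEmbedding.integral_map (μ := μ) F
    simp only [Homeomorph.coe_mulRight] at h
    rw [← h, hmap y, integral_smul_nnreal_measure]
    rfl
  refine ⟨c, ?_, hc⟩
  -- Testing on one bump `v` exhibits `c y` as `∫ v (x * y) / ∫ v`, a parameter integral with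
  -- locally uniform compact support.
  obtain ⟨v, hvc, hv, hv1⟩ := exists_continuous_nonneg_pos (1 : G)
  have hI : 0 < ∫ y, v y ∂μ :=
    v.continuous.integral_pos_of_hasCompactSupport_nonneg_nonzero hvc hv hv1
  have hcv : ∀ y, c y = (∫ x, v (x * y) ∂μ) / ∫ x, v x ∂μ := fun y => by
    have h := hc y fun x => (v x : ℂ)
    rw [integral_complex_ofReal, integral_complex_ofReal, Complex.real_smul] at h
    rw [eq_div_iff hI.ne']
    exact_mod_cast h.symm
  rw [funext hcv]
  refine Continuous.div_const (continuous_iff_continuousAt.mpr fun y₀ => ?_) _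
  obtain ⟨V, hV, K, hK, hVK⟩ := exists_isCompact_forall_mul_eq_zero hvc y₀
  refine (continuousOn_integral_of_compact_support hK (s := V) ?_ ?_).continuousAt hV
  · exact Continuous.continuousOn (by unfold Function.uncurry; fun_prop)
  · exact fun y x hy hx => hVK y hy x hx

/-- Right translates of a continuous compactly supported function, scaled by a continuous
factor, depend continuously on the translation in the `L¹`-norm. -/
theorem tendsto_integral_norm_sub_mul_inv (μ : Measure G) [μ.IsHaarMeasure] {c : G → ℝ}
    (hc : Continuous c) {u : G → ℂ} (hu : Continuous u) (huc : HasCompactSupport u) (y₀ : G) :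
    Tendsto (fun y => ∫ x, ‖c y • u (x * y⁻¹) - c y₀ • u (x * y₀⁻¹)‖ ∂μ) (𝓝 y₀) (𝓝 0) := by
  obtain ⟨V, hV, K, hK, hVK⟩ := exists_isCompact_forall_mul_eq_zero huc y₀⁻¹
  have hV' : Inv.inv ⁻¹' V ∈ 𝓝 y₀ := continuous_inv.continuousAt hV
  have h := (continuousOn_integral_of_compact_support (μ := μ) hK (s := Inv.inv ⁻¹' V)
    (f := fun y x => ‖c y • u (x * y⁻¹) - c y₀ • u (x * y₀⁻¹)‖)
    (Continuous.continuousOn (by unfold Function.uncurry; fun_prop)) (fun y x hy hx => by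
      rw [hVK _ hy _ hx, hVK _ (mem_of_mem_nhds hV) _ hx]; simp)).continuousAt hV'
  have h2 := h.tendsto
  simpa using h2

variable {μ : Measure G} [μ.IsHaarMeasure] [μ.Regular] (S : SegalAlgebra μ)

namespace SegalAlgebra

/-- For general `f` the map `y ↦ f ∘ L_y` need not be norm continuous. After smoothing by `u`, the
variable `y` can be moved onto `u` as a scaled right translation, and the norm of the difference is
at most `‖f‖` times the `L¹`-distance of the translates. -/
theorem continuous_comp_l1Act_comp_translate {u : G → ℂ} (hu : Continuous u)
    (huc : HasCompactSupport u) (f : StrongDual ℂ S) :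
    Continuous fun y : G => (f ∘L S.l1Act ((hu.memLp_of_hasCompactSupport huc).toLp u)) ∘L
      (S.translate y).toContinuousLinearMap := by
  obtain ⟨c, hc, hcF⟩ := exists_continuous_integral_mul_right μ
  set e := (hu.memLp_of_hasCompactSupport (μ := μ) (p := 1) huc).toLp u
  have hae : e =ᵐ[μ] u := MemLp.coeFn_toLp _
  have hui : ∀ y : G, Integrable (fun x => u (x * y⁻¹)) μ := fun y =>
    (hu.comp (continuous_mul_const y⁻¹)).integrable_of_hasCompactSupport
      (huc.comp_homeomorph (Homeomorph.mulRight y⁻¹))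
  have hformula : ∀ (y : G) (s : S), f (S.l1Act e (S.translate y s)) =
      ∫ x, (c y • u (x * y⁻¹)) * f (S.translate x s) ∂μ := fun y s => by
    have h1 := f.integral_comp_comm (S.integrable_translate e (S.translate y s))
    rw [← l1Act_apply] at h1
    rw [← h1]
    have h2 := hcF y fun x => u (x * y⁻¹) * f (S.translate x s)
    simp only [mul_inv_cancel_right] at h2
    simp only [smul_mul_assoc]
    rw [integral_smul, ← h2]
    refine integral_congr_ae ?_
    filter_upwards [hae] with x hx
    rw [hx, map_smul, smul_eq_mul, ← translate_mul]
  have hint : ∀ (y : G) (s : S),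
      Integrable (fun x => (c y • u (x * y⁻¹)) * f (S.translate x s)) μ := fun y s =>
    integrable_smul_of_bounded ((hui y).smul (c y))
      (f.continuous.comp (S.continuous_translate_apply s)) (C := ‖f‖ * ‖s‖) fun x => by
        simpa using f.le_opNorm (S.translate x s)
  refine continuous_iff_continuousAt.mpr fun y₀ => tendsto_iff_norm_sub_tendsto_zero.mpr ?_
  have hlim := (tendsto_integral_norm_sub_mul_inv μ hc hu huc y₀).mul_const ‖f‖
  rw [zero_mul] at hlim
  refine squeeze_zero (fun _ => norm_nonneg _) (fun y => ?_) hlim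
  refine ContinuousLinearMap.opNorm_le_bound _
    (mul_nonneg (integral_nonneg fun _ => norm_nonneg _) (norm_nonneg _)) fun s => ?_
  change ‖f (S.l1Act e (S.translate y s)) - f (S.l1Act e (S.translate y₀ s))‖ ≤ _
  rw [hformula, hformula, ← integral_sub (hint y s) (hint y₀ s), mul_assoc, ← integral_mul_const]
  refine norm_integral_le_of_norm_le
    ((((hui y).smul (c y)).sub ((hui y₀).smul (c y₀))).norm.mul_const _)
    (Eventually.of_forall fun x => ?_)
  rw [← sub_mul, norm_mul]
  refine mul_le_mul_of_nonneg_left ?_ (norm_nonneg _)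
  simpa using f.le_opNorm (S.translate x s)

/-- A translation-covariant functional on `S(G)*` gives rise to a module-covariant one. -/
theorem isLeftAmenable_of_translate {φ : WeakDual.characterSpace ℂ S} {χ : G →* ℂ}
    (hφ : ∀ b, φ b = ∫ y, S.incl b y * χ y ∂μ) (N : Bidual S)
    (hN1 : N (WeakDual.CharacterSpace.toCLM φ) = 1)
    (hN : ∀ (y : G) (f : StrongDual ℂ S),
      N (f ∘L (S.translate y).toContinuousLinearMap) = χ y * N f) : IsLeftAmenable φ := by
  obtain ⟨a₀, ha₀⟩ := exists_char_eq_one φ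
  -- For smoothed functionals, `g · b = ∫ b(y) (g ∘ L_y) dy` is a norm-convergent Bochner integral,
  -- so `N` passes under it.
  have hconv : ∀ {u : G → ℂ} (hu : Continuous u) (huc : HasCompactSupport u)
      (f : StrongDual ℂ S) (b : S),
      N ((f ∘L S.l1Act ((hu.memLp_of_hasCompactSupport huc).toLp u)) ∘L
        ContinuousLinearMap.mul ℂ S b) =
      φ b * N (f ∘L S.l1Act ((hu.memLp_of_hasCompactSupport huc).toLp u)) := by
    intro u hu huc f b
    have hcont := S.continuous_comp_l1Act_comp_translate hu huc f
    set g := f ∘L S.l1Act ((hu.memLp_of_hasCompactSupport huc).toLp u)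
    have hint : Integrable (fun y => S.incl b y •
        (g ∘L (S.translate y).toContinuousLinearMap)) μ :=
      integrable_smul_of_bounded (L1.integrable_coeFn _) hcont (C := ‖g‖) fun y =>
        ContinuousLinearMap.opNorm_le_bound _ (norm_nonneg _) fun s => by
          simpa using g.le_opNorm (S.translate y s)
    have hg : g ∘L ContinuousLinearMap.mul ℂ S b =
        ∫ y, S.incl b y • (g ∘L (S.translate y).toContinuousLinearMap) ∂μ := by
      ext s
      rw [ContinuousLinearMap.integral_apply hint]
      change g (b * s) = _
      rw [mul_eq_integral, ← g.integral_comp_comm (S.integrable_translate _ s)]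
      simp
    rw [hg, ← N.integral_comp_comm hint, hφ, ← integral_mul_const]
    simp only [map_smul, hN, smul_eq_mul, mul_assoc]
  -- Smoothing `f` by `u` amounts to replacing `b` by `u * b`, which is as close to `b` as desired.
  have hker : ∀ (f : StrongDual ℂ S) (b : S), φ b = 0 →
      N (f ∘L ContinuousLinearMap.mul ℂ S b) = 0 := by
    intro f b hb
    refine norm_le_zero_iff.mp (le_of_forall_pos_le_add fun ε hε => ?_)
    obtain ⟨u, hu, huc, hub⟩ := S.exists_l1Act_sub_le b
      (ε := ε / (‖N‖ * ‖f‖ + 1)) (by positivity)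
    set e := (hu.memLp_of_hasCompactSupport (μ := μ) (p := 1) huc).toLp u
    have h0 : N (f ∘L ContinuousLinearMap.mul ℂ S (S.l1Act e b)) = 0 := by
      rw [show f ∘L ContinuousLinearMap.mul ℂ S (S.l1Act e b) =
        (f ∘L S.l1Act e) ∘L ContinuousLinearMap.mul ℂ S b from
          ContinuousLinearMap.ext fun s => by simp [l1Act_mul], hconv hu huc, hb, zero_mul]
    have h1 : N (f ∘L ContinuousLinearMap.mul ℂ S b) =
        -N (f ∘L ContinuousLinearMap.mul ℂ S (S.l1Act e b - b)) := by
      rw [map_sub, ContinuousLinearMap.comp_sub, map_sub, h0, zero_sub, neg_neg]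
    rw [h1, norm_neg, zero_add]
    calc _ ≤ ‖N‖ * (‖f‖ * (ε / (‖N‖ * ‖f‖ + 1))) := by
          refine (N.le_opNorm _).trans ?_
          gcongr
          refine (ContinuousLinearMap.opNorm_comp_le _ _).trans ?_
          gcongr
          exact (ContinuousLinearMap.opNorm_mul_apply_le ℂ S _).trans hub
      _ = (‖N‖ * ‖f‖) / (‖N‖ * ‖f‖ + 1) * ε := by ring
      _ ≤ 1 * ε := by
          gcongr
          rw [div_le_one (by positivity)]
          linarith
      _ = ε := one_mul ε
  have hmul : ∀ (f : StrongDual ℂ S) (b : S), N (f ∘L ContinuousLinearMap.mul ℂ S b) =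
      φ b * N (f ∘L ContinuousLinearMap.mul ℂ S a₀) := fun f b => by
    have h := hker f (b - φ b • a₀) (by
      rw [map_sub, map_smul, ha₀, smul_eq_mul, mul_one, sub_self])
    rw [map_sub, map_smul, ContinuousLinearMap.comp_sub, ContinuousLinearMap.comp_smul, map_sub,
      map_smul, sub_eq_zero] at h
    exact h
  -- `hmul` compares `N (f · b)` with `N (f · a₀)` rather than with `N f`, so `f ↦ N (f · a₀)` takes
  -- the place of `N`.
  refine ⟨N ∘L (ContinuousLinearMap.precomp ℂ (ContinuousLinearMap.mul ℂ S a₀)), ?_,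
    fun a f => ?_⟩
  · change N (WeakDual.CharacterSpace.toCLM φ ∘L ContinuousLinearMap.mul ℂ S a₀) = 1
    rw [show WeakDual.CharacterSpace.toCLM φ ∘L ContinuousLinearMap.mul ℂ S a₀ =
      WeakDual.CharacterSpace.toCLM φ from ContinuousLinearMap.ext fun s => by
        change φ (a₀ * s) = φ s
        rw [map_mul, ha₀, one_mul], hN1]
  · change N ((f ∘L ContinuousLinearMap.mul ℂ S a) ∘L ContinuousLinearMap.mul ℂ S a₀) =
      φ a * N (f ∘L ContinuousLinearMap.mul ℂ S a₀)
    rw [show (f ∘L ContinuousLinearMap.mul ℂ S a) ∘L ContinuousLinearMap.mul ℂ S a₀ =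
      f ∘L ContinuousLinearMap.mul ℂ S (a * a₀) from ContinuousLinearMap.ext fun s => by
        simp [mul_assoc], hmul, map_mul, ha₀, mul_one]

end SegalAlgebra

end RightTranslation

/-! ### Positive parts of functionals on normed lattices -/

section PositivePart

variable {E : Type*} [NormedAddCommGroup E] [Lattice E] [NormedSpace ℝ E]

/-- The positive part of a functional on the positive cone: `f ↦ sup {m g | 0 ≤ g ≤ f}`. -/
def coneSup (m : E →L[ℝ] ℝ) (f : E) : ℝ := sSup (m '' Set.Icc 0 f)

theorem coneSup_le (m : E →L[ℝ] ℝ) {f : E} (hf : 0 ≤ f) {C : ℝ}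
    (h : ∀ g ∈ Set.Icc 0 f, m g ≤ C) : coneSup m f ≤ C :=
  csSup_le ((Set.nonempty_Icc.mpr hf).image m) (by rintro _ ⟨g, hg, rfl⟩; exact h g hg)

/-- An order automorphism carries the interval `[0, f]` onto `[0, T f]`. -/
theorem coneSup_map (m : E →L[ℝ] ℝ) {T U : E →+ E} (hT : Monotone T) (hU : Monotone U)
    (hUT : ∀ f, U (T f) = f) (hTU : ∀ f, T (U f) = f) (hm : ∀ f, m (T f) = m f) (f : E) :
    coneSup m (T f) = coneSup m f := by
  unfold coneSup
  congr 1
  ext r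
  constructor
  · rintro ⟨g, hg, rfl⟩
    refine ⟨U g, ⟨?_, ?_⟩, by rw [← hm, hTU]⟩
    · simpa using hU hg.1
    · simpa [hUT] using hU hg.2
  · rintro ⟨g, hg, rfl⟩
    refine ⟨T g, ⟨?_, hT hg.2⟩, hm g⟩
    simpa using hT hg.1

variable [HasSolidNorm E] [IsOrderedAddMonoid E]

theorem apply_le_of_mem_Icc (m : E →L[ℝ] ℝ) {f g : E} (hg : g ∈ Set.Icc 0 f) :
    m g ≤ ‖m‖ * ‖f‖ := by
  refine (le_abs_self _).trans ((m.le_opNorm g).trans ?_)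
  gcongr
  refine norm_le_norm_of_abs_le_abs ?_
  rw [abs_of_nonneg hg.1, abs_of_nonneg (hg.1.trans hg.2)]
  exact hg.2

theorem bddAbove_image_Icc (m : E →L[ℝ] ℝ) (f : E) : BddAbove (m '' Set.Icc 0 f) :=
  ⟨‖m‖ * ‖f‖, by rintro _ ⟨g, hg, rfl⟩; exact apply_le_of_mem_Icc m hg⟩

theorem le_coneSup (m : E →L[ℝ] ℝ) {f g : E} (hg : g ∈ Set.Icc 0 f) : m g ≤ coneSup m f :=
  le_csSup (bddAbove_image_Icc m f) ⟨g, hg, rfl⟩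

theorem coneSup_nonneg (m : E →L[ℝ] ℝ) {f : E} (hf : 0 ≤ f) : 0 ≤ coneSup m f := by
  simpa using le_coneSup m (Set.left_mem_Icc.mpr hf)

/-- Riesz decomposition: an `h` in `[0, f + g]` splits as `h ⊓ f` in `[0, f]` plus a remainder in
`[0, g]`. -/
theorem coneSup_add (m : E →L[ℝ] ℝ) {f g : E} (hf : 0 ≤ f) (hg : 0 ≤ g) :
    coneSup m (f + g) = coneSup m f + coneSup m g := by
  refine le_antisymm (coneSup_le m (add_nonneg hf hg) fun h hh => ?_) ?_
  · have h1 : h ⊓ f ∈ Set.Icc 0 f := ⟨le_inf hh.1 hf, inf_le_right⟩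
    have h2 : h - h ⊓ f ∈ Set.Icc 0 g := by
      refine ⟨sub_nonneg.mpr inf_le_left, ?_⟩
      rw [sub_le_iff_le_add, add_inf]
      exact le_inf (le_add_of_nonneg_left hg) (by rw [add_comm]; exact hh.2)
    calc m h = m (h ⊓ f) + m (h - h ⊓ f) := by rw [← map_add, add_sub_cancel]
      _ ≤ _ := add_le_add (le_coneSup m h1) (le_coneSup m h2)
  · rw [← le_sub_iff_add_le]
    refine coneSup_le m hf fun a ha => ?_
    rw [le_sub_comm]
    refine coneSup_le m hg fun b hb => ?_
    rw [le_sub_iff_add_le, add_comm, ← map_add]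
    exact le_coneSup m ⟨add_nonneg ha.1 hb.1, add_le_add ha.2 hb.2⟩

/-- The positive part of a bounded functional on a normed vector lattice. -/
theorem exists_positive_part (m : E →L[ℝ] ℝ) : ∃ P : E →L[ℝ] ℝ,
    (∀ f, 0 ≤ f → 0 ≤ P f ∧ m f ≤ P f) ∧
    ∀ T U : E →+ E, Monotone T → Monotone U → (∀ f, U (T f) = f) → (∀ f, T (U f) = f) →
      (∀ f, m (T f) = m f) → ∀ f, P (T f) = P f := by
  -- The extension from the cone does not depend on how `f` is written as a difference of positive
  -- elements; additivity and invariance both follow from this.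
  have hsub : ∀ f a b : E, 0 ≤ a → 0 ≤ b → f = a - b →
      coneSup m f⁺ - coneSup m f⁻ = coneSup m a - coneSup m b := by
    intro f a b ha hb hab
    have h : f⁺ + b = a + f⁻ := by
      rw [← sub_eq_sub_iff_add_eq_add, posPart_sub_negPart, hab]
    have h2 := congrArg (coneSup m) h
    rw [coneSup_add m (posPart_nonneg f) hb, coneSup_add m ha (negPart_nonneg f)] at h2
    linarith
  let P₀ : E →+ ℝ := AddMonoidHom.mk' (fun f => coneSup m f⁺ - coneSup m f⁻) fun f g => by
    rw [hsub (f + g) (f⁺ + g⁺) (f⁻ + g⁻) (add_nonneg (posPart_nonneg f) (posPart_nonneg g))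
      (add_nonneg (negPart_nonneg f) (negPart_nonneg g)) (by
        rw [add_sub_add_comm, posPart_sub_negPart, posPart_sub_negPart]),
      coneSup_add m (posPart_nonneg f) (posPart_nonneg g),
      coneSup_add m (negPart_nonneg f) (negPart_nonneg g)]
    ring
  have hP₀ : ∀ f, P₀ f = coneSup m f⁺ - coneSup m f⁻ := fun f => rfl
  have hcont : Continuous P₀ := by
    refine AddMonoidHomClass.continuous_of_bound P₀ ‖m‖ fun f => ?_
    have key : ∀ g : E, 0 ≤ g → g ≤ |f| → coneSup m g ≤ ‖m‖ * ‖f‖ := fun g hg hgf => by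
      refine (coneSup_le m hg fun a ha => apply_le_of_mem_Icc m ha).trans ?_
      gcongr
      exact norm_le_norm_of_abs_le_abs (by rwa [abs_of_nonneg hg])
    have h1 := key f⁺ (posPart_nonneg f) (sup_le (le_abs_self f) (abs_nonneg f))
    have h2 := key f⁻ (negPart_nonneg f) (sup_le (neg_le_abs f) (abs_nonneg f))
    have h3 := coneSup_nonneg m (posPart_nonneg f)
    have h4 := coneSup_nonneg m (negPart_nonneg f)
    rw [hP₀, Real.norm_eq_abs, abs_le]
    constructor <;> linarith
  have hpos : ∀ f, 0 ≤ f → P₀ f = coneSup m f := fun f hf => by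
    rw [hP₀, hsub f f 0 hf le_rfl (sub_zero f).symm]
    have := coneSup_add m (le_refl (0 : E)) (le_refl 0)
    rw [add_zero] at this
    linarith
  refine ⟨P₀.toRealLinearMap hcont, fun f hf => ?_, fun T U hT hU hUT hTU hm f => ?_⟩
  · change 0 ≤ P₀ f ∧ m f ≤ P₀ f
    rw [hpos f hf]
    exact ⟨coneSup_nonneg m hf, le_coneSup m (Set.right_mem_Icc.mpr hf)⟩
  · change P₀ (T f) = P₀ f
    have hT0 : ∀ g, 0 ≤ g → 0 ≤ T g := fun g hg => by simpa using hT hg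
    rw [hP₀, hP₀, hsub (T f) (T f⁺) (T f⁻) (hT0 _ (posPart_nonneg f)) (hT0 _ (negPart_nonneg f))
      (by rw [← map_sub, posPart_sub_negPart]), coneSup_map m hT hU hUT hTU hm,
      coneSup_map m hT hU hUT hTU hm]

end PositivePart

/-! ### Norm bounds in `L^∞` -/

section EssentiallyBounded

variable {X : Type*} [MeasurableSpace X] {μ : Measure X}

theorem memLp_top_of_continuous [TopologicalSpace X] [OpensMeasurableSpace X] {f : X → ℂ} (hf : Continuous f) {C : ℝ}
    (hC : ∀ x, ‖f x‖ ≤ C) :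
    MemLp f ∞ μ :=
  memLp_top_of_bound hf.aestronglyMeasurable C (Eventually.of_forall hC)

theorem norm_toLp_top_le {E : Type*} [NormedAddCommGroup E] {f : X → E} (hf : MemLp f ∞ μ) {C : ℝ}
    (hC0 : 0 ≤ C) (hC : ∀ᵐ x ∂μ, ‖f x‖ ≤ C) : ‖hf.toLp f‖ ≤ C := by
  rw [Lp.norm_toLp, eLpNorm_exponent_top]
  refine ENNReal.toReal_le_of_le_ofReal hC0 (eLpNormEssSup_le_of_ae_bound hC)

theorem ae_norm_le_norm_top {E : Type*} [NormedAddCommGroup E] (f : Lp E ∞ μ) :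
    ∀ᵐ x ∂μ, ‖f x‖ ≤ ‖f‖ := by
  filter_upwards [ae_le_eLpNormEssSup (f := f) (μ := μ)] with x hx
  rw [Lp.norm_def, eLpNorm_exponent_top]
  have hfin : eLpNormEssSup f μ ≠ ∞ := by
    rw [← eLpNorm_exponent_top]; exact Lp.eLpNorm_ne_top f
  simpa using ENNReal.toReal_mono hfin hx

end EssentiallyBounded

/-! ### From an invariant functional to an invariant mean -/

section Mean

variable {G : Type*} [Group G] [TopologicalSpace G] [IsTopologicalGroup G]
  [MeasurableSpace G] [BorelSpace G] (μ : Measure G) [μ.IsMulLeftInvariant]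

/-- Left translation on the real space `L^∞(G)`. -/
def realTranslate (y : G) : Lp ℝ ∞ μ →ₗᵢ[ℝ] Lp ℝ ∞ μ :=
  Lp.compMeasurePreservingₗᵢ ℝ (fun x => y⁻¹ * x) (measurePreserving_mul_left μ y⁻¹)

theorem realTranslate_ae (y : G) (f : Lp ℝ ∞ μ) :
    realTranslate μ y f =ᵐ[μ] fun x => f (y⁻¹ * x) :=
  Lp.coeFn_compMeasurePreserving f (measurePreserving_mul_left μ y⁻¹)

variable {μ} in
theorem ae_mul_left {p : G → Prop} (h : ∀ᵐ x ∂μ, p x) (y : G) : ∀ᵐ x ∂μ, p (y * x) :=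
  (measurePreserving_mul_left μ y).quasiMeasurePreserving.ae h

theorem realTranslate_realTranslate (y z : G) (hyz : y * z = 1) (f : Lp ℝ ∞ μ) :
    realTranslate μ y (realTranslate μ z f) = f := by
  refine Lp.ext ?_
  filter_upwards [realTranslate_ae μ y (realTranslate μ z f),
    ae_mul_left (realTranslate_ae μ z f) y⁻¹] with x h1 h2
  rw [h1, h2, ← mul_assoc, ← mul_inv_rev, hyz, inv_one, one_mul]

theorem realTranslate_monotone (y : G) : Monotone (realTranslate μ y) := fun f g hfg => by
  rw [← Lp.coeFn_le] at hfg ⊢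
  filter_upwards [realTranslate_ae μ y f, realTranslate_ae μ y g, ae_mul_left hfg y⁻¹]
    with x h1 h2 h3
  rw [h1, h2]
  exact h3

theorem ofReal_realTranslate (y : G) (f : Lp ℝ ∞ μ) :
    Complex.ofRealCLM.compLpL ∞ μ (realTranslate μ y f) =
      leftTranslate μ ∞ y (Complex.ofRealCLM.compLpL ∞ μ f) := by
  refine Lp.ext ?_
  filter_upwards [leftTranslate_ae μ ∞ y (Complex.ofRealCLM.compLpL ∞ μ f),
    Complex.ofRealCLM.coeFn_compLp (realTranslate μ y f), realTranslate_ae μ y f,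
    ae_mul_left (Complex.ofRealCLM.coeFn_compLp f) y⁻¹] with x h1 h2 h3 h4
  rw [h1]
  change (Complex.ofRealCLM.compLp _ : Lp ℂ ∞ μ) x = (Complex.ofRealCLM.compLp f : Lp ℂ ∞ μ) _
  rw [h2, h3, h4]

theorem re_leftTranslate (y : G) (f : Lp ℂ ∞ μ) :
    Complex.reCLM.compLpL ∞ μ (leftTranslate μ ∞ y f) =
      realTranslate μ y (Complex.reCLM.compLpL ∞ μ f) := by
  refine Lp.ext ?_
  filter_upwards [realTranslate_ae μ y (Complex.reCLM.compLpL ∞ μ f),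
    Complex.reCLM.coeFn_compLp (leftTranslate μ ∞ y f), leftTranslate_ae μ ∞ y f,
    ae_mul_left (Complex.reCLM.coeFn_compLp f) y⁻¹] with x h1 h2 h3 h4
  rw [h1]
  change (Complex.reCLM.compLp _ : Lp ℝ ∞ μ) x = (Complex.reCLM.compLp f : Lp ℝ ∞ μ) _
  rw [h2, h3, h4]

/-- A translation-invariant bounded functional on `L^∞(G)` with value `1` at the constant `1`
yields a left-invariant mean. -/
theorem isAmenable_of_functional (m : Lp ℂ ∞ μ →L[ℂ] ℂ)
    (hm1 : m ((memLp_top_const (1 : ℂ)).toLp (fun _ : G => (1 : ℂ))) = 1)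
    (hm : ∀ (y : G) (f : Lp ℂ ∞ μ), m (leftTranslate μ ∞ y f) = m f) : IsAmenable μ := by
  set one : Lp ℝ ∞ μ := (memLp_top_const (1 : ℝ)).toLp (fun _ : G => (1 : ℝ))
  set oneC : Lp ℂ ∞ μ := (memLp_top_const (1 : ℂ)).toLp (fun _ : G => (1 : ℂ))
  have one_ae : one =ᵐ[μ] fun _ => 1 := MemLp.coeFn_toLp _
  have oneC_ae : oneC =ᵐ[μ] fun _ => 1 := MemLp.coeFn_toLp _
  -- `m` need not be positive. The positive part of its real part on real functions is still
  -- invariant, and it is at least `1` at the constant `1`, so it can be normalised.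
  obtain ⟨P, hP, hPinv⟩ := exists_positive_part
    (Complex.reCLM ∘L m.restrictScalars ℝ ∘L Complex.ofRealCLM.compLpL ∞ μ)
  have hPtrans : ∀ y f, P (realTranslate μ y f) = P f := fun y =>
    hPinv (realTranslate μ y).toLinearMap.toAddMonoidHom
      (realTranslate μ y⁻¹).toLinearMap.toAddMonoidHom (realTranslate_monotone μ y)
      (realTranslate_monotone μ y⁻¹) (realTranslate_realTranslate μ _ _ (inv_mul_cancel y))
      (realTranslate_realTranslate μ _ _ (mul_inv_cancel y)) fun f => by
        change (m (Complex.ofRealCLM.compLpL ∞ μ (realTranslate μ y f))).re = _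
        rw [ofReal_realTranslate, hm]
        rfl
  have hone0 : 0 ≤ one := by
    rw [← Lp.coeFn_nonneg]
    filter_upwards [one_ae] with x hx
    rw [hx]
    exact zero_le_one
  have hP1 : 1 ≤ P one := by
    refine le_trans (le_of_eq ?_) (hP one hone0).2
    change 1 = (m (Complex.ofRealCLM.compLpL ∞ μ one)).re
    have : Complex.ofRealCLM.compLpL ∞ μ one = oneC := by
      refine Lp.ext ?_
      filter_upwards [Complex.ofRealCLM.coeFn_compLp one, one_ae, oneC_ae] with x h1 h2 h3
      change (Complex.ofRealCLM.compLp one : Lp ℂ ∞ μ) x = _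
      rw [h1, h2, h3]
      simp
    rw [this, hm1, Complex.one_re]
  have hPpos : 0 < P one := by linarith
  have hle : ∀ u : Lp ℝ ∞ μ, P u ≤ P one * ‖u‖ := fun u => by
    have h : 0 ≤ ‖u‖ • one - u := by
      rw [← Lp.coeFn_nonneg]
      filter_upwards [Lp.coeFn_sub (‖u‖ • one) u, Lp.coeFn_smul ‖u‖ one, one_ae,
        ae_norm_le_norm_top u] with x h1 h2 h3 h4
      rw [h1, Pi.sub_apply, h2, Pi.smul_apply, h3, smul_eq_mul, mul_one]
      exact sub_nonneg.mpr ((le_abs_self _).trans h4)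
    have h2 := (hP _ h).1
    rw [map_sub, map_smul, smul_eq_mul] at h2
    linarith
  have habs : ∀ u : Lp ℝ ∞ μ, ‖P u‖ ≤ P one * ‖u‖ := fun u => by
    rw [Real.norm_eq_abs, abs_le]
    have h2 := hle (-u)
    rw [map_neg, norm_neg] at h2
    exact ⟨by linarith, hle u⟩
  let Q : StrongDual ℝ (Lp ℂ ∞ μ) := (P one)⁻¹ • (P ∘L Complex.reCLM.compLpL ∞ μ)
  have hQ : ∀ f, Q f = (P one)⁻¹ * P (Complex.reCLM.compLpL ∞ μ f) := fun f => rfl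
  have hQnorm : ‖Q‖ ≤ 1 := by
    refine ContinuousLinearMap.opNorm_le_bound _ zero_le_one fun f => ?_
    rw [hQ, norm_mul, norm_inv, Real.norm_of_nonneg hPpos.le, one_mul, inv_mul_le_iff₀ hPpos]
    refine (habs _).trans ?_
    gcongr
    have h := Complex.reCLM.norm_compLp_le f
    rwa [Complex.reCLM_norm, one_mul] at h
  have hQinv : ∀ y f, Q (leftTranslate μ ∞ y f) = Q f := fun y f => by
    rw [hQ, hQ, re_leftTranslate, hPtrans]
  have hre : ∀ z : ℂ, Complex.reCLM.compLpL ∞ μ (z • oneC) = z.re • one := fun z => by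
    refine Lp.ext ?_
    filter_upwards [Complex.reCLM.coeFn_compLp (z • oneC), one_ae, oneC_ae,
      Lp.coeFn_smul z oneC, Lp.coeFn_smul z.re one] with x h1 h2 h3 h4 h5
    change (Complex.reCLM.compLp (z • oneC) : Lp ℝ ∞ μ) x = _
    rw [h1, h4, h5, Pi.smul_apply, Pi.smul_apply, h2, h3]
    simp
  -- The complex mean is `f ↦ Q f - i Q (i f)`; this complexification preserves the norm of `Q`.
  have hQ1 : (Q.extendRCLike : StrongDual ℂ (Lp ℂ ∞ μ)) oneC = 1 := by
    have h1 : Q oneC = 1 := by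
      rw [hQ, ← one_smul ℂ oneC, hre, Complex.one_re, one_smul, inv_mul_cancel₀ hPpos.ne']
    have h2 : Q (Complex.I • oneC) = 0 := by
      rw [hQ, hre, Complex.I_re, zero_smul, map_zero, mul_zero]
    rw [StrongDual.extendRCLike_apply]
    change ((Q oneC : ℝ) : ℂ) - Complex.I * ((Q (Complex.I • oneC) : ℝ) : ℂ) = 1
    rw [h1, h2]
    simp
  refine ⟨Q.extendRCLike, le_antisymm ?_ ?_, hQ1, fun y f => ?_⟩
  · rw [StrongDual.norm_extendRCLike]
    exact hQnorm
  · have h := (Q.extendRCLike : StrongDual ℂ (Lp ℂ ∞ μ)).le_opNorm oneC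
    rw [hQ1, norm_one] at h
    refine h.trans (mul_le_of_le_one_right (norm_nonneg _) ?_)
    exact norm_toLp_top_le _ zero_le_one (Eventually.of_forall fun _ => by simp)
  · rw [StrongDual.extendRCLike_apply, StrongDual.extendRCLike_apply, hQinv, ← map_smul, hQinv]

end Mean

/-! ### Amenability of the group and left character-amenability of the Segal algebra -/

section Amenability

variable {G : Type*} [Group G] [TopologicalSpace G] [IsTopologicalGroup G]
  [LocallyCompactSpace G] [MeasurableSpace G] [BorelSpace G]
  {μ : Measure G} [μ.IsHaarMeasure] [μ.Regular] {S : SegalAlgebra μ}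

theorem IsLeftAmenable.isAmenable {φ : WeakDual.characterSpace ℂ S} (h : IsLeftAmenable φ) :
    IsAmenable μ := by
  obtain ⟨N, hN1, hN⟩ := h
  obtain ⟨χ, hχc, ⟨C, hC⟩, hχ, hφ⟩ := S.exists_monoidHom_of_char φ
  obtain ⟨e, he⟩ := exists_char_eq_one φ
  have hNtrans : ∀ (y : G) (f : StrongDual ℂ S),
      N (f ∘L (S.translate y).toContinuousLinearMap) = χ y * N f := fun y f => by
    have h1 := hN e (f ∘L (S.translate y).toContinuousLinearMap)
    rw [he, one_mul] at h1
    rw [← h1, show (f ∘L (S.translate y).toContinuousLinearMap) ∘L ContinuousLinearMap.mul ℂ S e =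
      f ∘L ContinuousLinearMap.mul ℂ S (S.translate y e) from ContinuousLinearMap.ext fun s => by
        simp [SegalAlgebra.translate_mul_aux], hN, hχ, he, mul_one]
  have hX := memLp_top_of_continuous (μ := μ) hχc hC
  let T : Lp ℂ ∞ μ →L[ℂ] StrongDual ℂ S :=
    ContinuousLinearMap.precomp ℂ S.incl ∘L
      ((ContinuousLinearMap.mul ℂ ℂ).lpPairing μ 1 ∞).flip ∘L
        (ContinuousLinearMap.mul ℂ ℂ).holderL μ ∞ ∞ ∞ (hX.toLp χ)
  have hT : ∀ f a, T f a = ∫ x, S.incl a x * (χ x * f x) ∂μ := fun f a => by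
    change (ContinuousLinearMap.mul ℂ ℂ).lpPairing μ 1 ∞ (S.incl a)
      ((ContinuousLinearMap.mul ℂ ℂ).holder ∞ (hX.toLp χ) f) = _
    rw [ContinuousLinearMap.lpPairing_eq_integral]
    refine integral_congr_ae ?_
    filter_upwards [(ContinuousLinearMap.mul ℂ ℂ).coeFn_holder (r := ∞) (hX.toLp χ) f,
      hX.coeFn_toLp] with x h1 h2
    rw [h1, h2]
    rfl
  -- The factor `χ y` appearing here cancels the `χ y⁻¹` that `N` produces from translation by
  -- `y⁻¹`.
  have hTtrans : ∀ y f, T (leftTranslate μ ∞ y f) =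
      χ y • (T f ∘L (S.translate y⁻¹).toContinuousLinearMap) := fun y f => by
    ext a
    change _ = χ y * T f (S.translate y⁻¹ a)
    rw [hT, hT, ← integral_const_mul, ← integral_mul_left_eq_self _ y]
    refine integral_congr_ae ?_
    filter_upwards [ae_mul_left (leftTranslate_ae μ ∞ y f) y,
      leftTranslate_ae μ 1 y⁻¹ (S.incl a)] with x h1 h2
    rw [h1, SegalAlgebra.incl_translate, h2, inv_inv, inv_mul_cancel_left, map_mul]
    ring
  refine isAmenable_of_functional μ (N ∘L T) ?_ fun y f => ?_
  · change N (T _) = 1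
    refine (congrArg N ?_).trans hN1
    ext a
    change _ = φ a
    rw [hT, hφ]
    refine integral_congr_ae ?_
    filter_upwards [(memLp_top_const (μ := μ) (1 : ℂ)).coeFn_toLp] with x hx
    rw [hx, mul_one]
  · change N (T _) = N (T f)
    rw [hTtrans, map_smul, hNtrans, smul_eq_mul, ← mul_assoc, ← map_mul, mul_inv_cancel, map_one,
      one_mul]

theorem IsAmenable.isLeftAmenable (h : IsAmenable μ) (φ : WeakDual.characterSpace ℂ S) :
    IsLeftAmenable φ := by
  obtain ⟨m, -, hm1, hm⟩ := h
  obtain ⟨χ, hχc, ⟨C, hC⟩, hχ, hφ⟩ := S.exists_monoidHom_of_char φ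
  obtain ⟨e, he⟩ := exists_char_eq_one φ
  have hC0 : 0 ≤ C := (norm_nonneg _).trans (hC 1)
  have hbound : ∀ (f : StrongDual ℂ S) (x : G),
      ‖χ x⁻¹ * f (S.translate x e)‖ ≤ C * ‖e‖ * ‖f‖ := fun f x => by
    rw [norm_mul, mul_assoc]
    refine mul_le_mul (hC _) ?_ (norm_nonneg _) hC0
    rw [mul_comm]
    simpa using f.le_opNorm (S.translate x e)
  have hmem : ∀ f : StrongDual ℂ S, MemLp (fun x => χ x⁻¹ * f (S.translate x e)) ∞ μ := fun f =>
    memLp_top_of_continuous ((hχc.comp continuous_inv).mul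
      (f.continuous.comp (S.continuous_translate_apply e))) (hbound f)
  -- The twist by `χ x⁻¹` makes `H φ = 1` and `H (f ∘ L_y) = χ y • L_{y⁻¹} (H f)`, so an invariant
  -- mean composed with `H` is translation-covariant.
  let H : StrongDual ℂ S →L[ℂ] Lp ℂ ∞ μ := LinearMap.mkContinuous
    { toFun := fun f => (hmem f).toLp _
      map_add' := fun f g => by
        rw [← MemLp.toLp_add]
        congr 1
        ext x
        simp [mul_add]
      map_smul' := fun c f => by
        rw [RingHom.id_apply, ← MemLp.toLp_const_smul]
        congr 1
        ext x
        simp [mul_left_comm] } (C * ‖e‖) fun f =>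
    norm_toLp_top_le (hmem f) (by positivity) (Eventually.of_forall (hbound f))
  have hH : ∀ f, H f =ᵐ[μ] fun x => χ x⁻¹ * f (S.translate x e) := fun f => (hmem f).coeFn_toLp
  refine S.isLeftAmenable_of_translate hφ (m ∘L H) ?_ fun y f => ?_
  · change m (H _) = 1
    rw [← hm1]
    congr 1
    refine Lp.ext ?_
    filter_upwards [hH (WeakDual.CharacterSpace.toCLM φ),
      (memLp_top_const (μ := μ) (1 : ℂ)).coeFn_toLp] with x h1 h2
    rw [h1, h2]
    change χ x⁻¹ * φ (S.translate x e) = 1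
    rw [hχ, he, mul_one, ← map_mul, inv_mul_cancel, map_one]
  · change m (H _) = χ y * m (H f)
    rw [← hm y⁻¹ (H f), ← smul_eq_mul, ← map_smul]
    congr 1
    refine Lp.ext ?_
    filter_upwards [hH (f ∘L (S.translate y).toContinuousLinearMap),
      Lp.coeFn_smul (χ y) (leftTranslate μ ∞ y⁻¹ (H f)), leftTranslate_ae μ ∞ y⁻¹ (H f),
      ae_mul_left (hH f) y] with x h1 h2 h3 h4
    have hχy : χ y * χ (y * x)⁻¹ = χ x⁻¹ := by
      rw [mul_comm, ← map_mul, mul_inv_rev, inv_mul_cancel_right]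
    rw [h1, h2, Pi.smul_apply, h3, inv_inv, h4, smul_eq_mul, ← mul_assoc, hχy,
      SegalAlgebra.translate_mul]
    rfl

end Amenability

end SegalBiflat

end

theorem mainTheorem1 {G : Type*} [Group G] [TopologicalSpace G] [IsTopologicalGroup G]
    [LocallyCompactSpace G] [T2Space G] [MeasurableSpace G] [BorelSpace G]
    (μ : Measure G) [μ.IsHaarMeasure] [μ.Regular]
    (S : SegalBiflat.SegalAlgebra μ) (φ : WeakDual.characterSpace ℂ S) :
    List.TFAE [
      SegalBiflat.IsLeftBiflat (A := SegalBiflat.Bidual S) (SegalBiflat.bidualChar φ),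
      SegalBiflat.IsLeftBiflat φ,
      SegalBiflat.IsAmenable μ] := by
  tfae_have 1 → 3 := fun h =>
    (h.isLeftAmenable_of_bidual S.mem_closure_range_mul).isAmenable
  tfae_have 2 → 3 := fun h => (h.isLeftAmenable S.mem_closure_range_mul).isAmenable
  tfae_have 3 → 1 := fun h => (h.isLeftAmenable φ).bidual.isLeftBiflat
  tfae_have 3 → 2 := fun h => (h.isLeftAmenable φ).isLeftBiflat
  tfae_finish
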